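/- Let $A:\mathbb N\times\mathbb N\to\{0,1\}$, let $\Sigma=\{x\in\mathbb N^{\mathbb N}: A(x_j,x_{j+1})=1\ \forall j\ge 0\}$ be the associated one-sided Markov shift with shift map $\sigma(x_0x_1x_2\dots)=x_1x_2\dots$, and let $d(x,y)=\lambda^{\inf\{j:\,x_j\ne y_j\}}$ with $\lambda\in(0,1)$ fixed ($d(x,x)=0$). For $j\in\mathbb N$ write $[j]=\{x\in\Sigma:x_0=j\}$. Assume that $\Sigma$ is topologically transitive: for all $i,j\in\mathbb N$ there is $n\ge 0$ with $\sigma^{-n}[j]\cap[i]\neq\emptyset$. For $g:\Sigma\to\mathbb R$ and $n\ge 0$ put $Var_n(g)=\sup\{|g(x)-g(y)|:d(x,y)\le\lambda^n\}\in[0,\infty]$. Let $f:\Sigma\to\mathbb R$ be coercive, i.e. $\lim_{j\to\infty}\sup\{f(x):x\in[j]\}=-\infty$, and of bounded variation, i.e. $\sum_{j\ge 1}Var_j(f)<\infty$. Let $m=\sup\{\int f\,d\mu:\mu\text{ a }\sigma\text{-invariant Borel probability measure on }\Sigma\}$, and let $\overline y$ be a point of the support of a maximizing measure, that is, of a $\sigma$-invariant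 Borel probability measure attaining this supremum. For $x\in\Sigma$ and $\epsilon>0$ put $$S_f^\epsilon(\overline y,x)=\sup_{n\ge 0}\ \sup\Big\{\sum_{j=0}^{n-1}\big(f(\sigma^j z)-m\big): z\in\Sigma,\ d(\overline y,z)<\epsilon,\ \sigma^n(z)=x\Big\}\in[-\infty,\infty].$$ Then for every $x\in\Sigma$ the limit $S_f(x)=\lim_{\epsilon\to 0^+}S_f^\epsilon(\overline y,x)$ (the Peierls barrier) exists and is a finite real number. Moreover: 1. $S_f$ is a calibrated subaction: $f(x)\le S_f(\sigma(x))-S_f(x)+m$ for all $x\in\Sigma$, and for every $x\in\Sigma$ there is $y\in\Sigma$ with $\sigma(y)=x$ and $f(y)=S_f(x)-S_f(y)+m$; 2. $S_f$ is uniformly continuous with respect to $d$, and $Var_n(S_f)\le\sum_{j\ge n}Var_j(f)$ for every $n\ge 0$; 3. $S_f$ is bounded above. -/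

import Mathlib

open MeasureTheory Filter Topology
open scoped ENNReal

/-- The one-sided Markov shift of a `0`-`1` incidence matrix `A` on the alphabet `ℕ`: the
sequences `x₀x₁x₂…` with `A (xⱼ, xⱼ₊₁) = 1` for all `j`. As a subtype of `ℕ → ℕ` it carries the
topology generated by the cylinders and the corresponding Borel `σ`-algebra. -/
abbrev MarkovShift (A : ℕ → ℕ → Fin 2) : Type :=
  {x : ℕ → ℕ // ∀ j, A (x j) (x (j + 1)) = 1}

namespace MarkovShift

variable {A : ℕ → ℕ → Fin 2}

/-- The shift map `σ (x₀x₁x₂…) = x₁x₂…`. -/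
def shift (x : MarkovShift A) : MarkovShift A :=
  ⟨fun j => x.1 (j + 1), fun j => x.2 (j + 1)⟩

/-- The cylinder `[j]` of length one. -/
def letterCylinder (A : ℕ → ℕ → Fin 2) (j : ℕ) : Set (MarkovShift A) :=
  {x | x.1 0 = j}

/-- Transitivity: for all letters `i, j` there is `n ≥ 0` such that `σ⁻ⁿ[j] ∩ [i]` is nonempty. -/
def IsTransitive (A : ℕ → ℕ → Fin 2) : Prop :=
  ∀ i j : ℕ, ∃ n : ℕ, ((shift^[n]) ⁻¹' letterCylinder A j ∩ letterCylinder A i).Nonempty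

open Classical in
/-- The distance `d_λ(x, y) = λ ^ inf {j | xⱼ ≠ yⱼ}`, which is `0` if `x = y`. -/
noncomputable def shiftDist (lam : ℝ) (x y : MarkovShift A) : ℝ :=
  if x = y then 0 else lam ^ sInf {j : ℕ | x.1 j ≠ y.1 j}

/-- The `n`-th variation `sup {|f x - f y| : d_λ(x, y) ≤ λ ^ n}`, with values in `[0, ∞]`. -/
noncomputable def variation (lam : ℝ) (f : MarkovShift A → ℝ) (n : ℕ) : ℝ≥0∞ :=
  ⨆ (x : MarkovShift A) (y : MarkovShift A) (_ : shiftDist lam x y ≤ lam ^ n),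
    ENNReal.ofReal |f x - f y|

/-- Bounded variation: `∑_{j ≥ 1} Var_j(f) < ∞`. -/
def HasBoundedVariation (lam : ℝ) (f : MarkovShift A → ℝ) : Prop :=
  ∑' j : ℕ, variation lam f (j + 1) < ∞

/-- Coercivity: `sup {f x : x ∈ [j]} → -∞` as `j → ∞`. -/
def IsCoercive (f : MarkovShift A → ℝ) : Prop :=
  Tendsto (fun j : ℕ => ⨆ x ∈ letterCylinder A j, (f x : EReal)) atTop (𝓝 ⊥)

/-- `μ` is a shift-invariant Borel probability measure. -/
def IsInvariantProb (μ : Measure (MarkovShift A)) : Prop :=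
  IsProbabilityMeasure μ ∧ MeasurePreserving shift μ μ

/-- The ergodic maximizing value `m(f) = sup {∫ f dμ : μ an invariant probability measure}` of a
potential that is continuous and bounded above. For such `f` an invariant probability measure
for which `f` is not integrable has `∫ f dμ = -∞`, so that it does not affect the supremum. -/
noncomputable def maxValue (f : MarkovShift A → ℝ) : ℝ :=
  sSup {c : ℝ | ∃ μ : Measure (MarkovShift A),
    IsInvariantProb μ ∧ Integrable f μ ∧ ∫ x, f x ∂μ = c}

/-- `μ` is a maximizing measure for `f`: an invariant probability measure that attains `m(f)`. -/
def IsMaximizingMeasure (f : MarkovShift A → ℝ) (μ : Measure (MarkovShift A)) : Prop :=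
  IsInvariantProb μ ∧ Integrable f μ ∧ ∫ x, f x ∂μ = maxValue f

/-- `V` is a subaction for `f`: `f x ≤ V (σ x) - V x + m(f)` for all `x`. -/
def IsSubaction (f V : MarkovShift A → ℝ) : Prop :=
  ∀ x, f x ≤ V (shift x) - V x + maxValue f

/-- `V` is a calibrated subaction for `f`: a subaction such that every `x` has a preimage `y`
under the shift with `f y = V x - V y + m(f)`. -/
def IsCalibratedSubaction (f V : MarkovShift A → ℝ) : Prop :=
  IsSubaction f V ∧ ∀ x, ∃ y, shift y = x ∧ f y = V x - V y + maxValue f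

/-- `S_f^ε(y, x) = sup_{n ≥ 0} sup_z {S_n(f - m)(z) : d(y, z) < ε, σⁿ z = x}`, in `[-∞, ∞]`. -/
noncomputable def peierlsEps (lam : ℝ) (f : MarkovShift A → ℝ) (ε : ℝ) (y x : MarkovShift A) :
    EReal :=
  ⨆ (n : ℕ) (z : MarkovShift A) (_ : shiftDist lam y z < ε ∧ shift^[n] z = x),
    ((birkhoffSum shift (fun w => f w - maxValue f) n z : ℝ) : EReal)

/-- The real function `S` is the Peierls barrier `S_f(y, ·)`: for every `x`, the limit of
`S_f^ε(y, x)` as `ε → 0⁺` exists in `[-∞, ∞]` and is the real number `S x`. -/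
def IsPeierlsBarrier (lam : ℝ) (f : MarkovShift A → ℝ) (y : MarkovShift A)
    (S : MarkovShift A → ℝ) : Prop :=
  ∀ x, Tendsto (fun ε : ℝ => peierlsEps lam f ε y x) (𝓝[>] 0) (𝓝 (S x : EReal))

/-- Uniform continuity with respect to the distance `d_λ`. -/
def IsUniformlyContinuous (lam : ℝ) (V : MarkovShift A → ℝ) : Prop :=
  ∀ ε > 0, ∃ δ > 0, ∀ x y, shiftDist lam x y < δ → |V x - V y| < ε

end MarkovShift

/-!
# The Peierls barrier of a coercive potential on a transitive Markov shift

Write `g = f - m(f)`. For a point `y`, consider the Birkhoff sums of `g` along the orbit segments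
that start in the cylinder of length `k` around `y`, have length at least `N` and end at `x`
(`arrivalSums`), and their supremum `barrier g y k N x`.

*Upper bound.* A periodic orbit carries an invariant probability measure, so `g` has nonpositive
sum over each period, and by bounded distortion `g` has sum at most `∑_{j ≥ 1} Var_j(f)` along
every closed word. By transitivity any segment can be closed at a cost that depends on its first
and last letters only. Coercivity leaves finitely many last letters to consider, since `g` is
negative on the others; this gives a bound that is uniform in `x`
(`IsNormalized.exists_birkhoffSum_le`).

*Lower bound.* The function `V = barrier g y 1 0` is a continuous subaction that is bounded above:
`g ≤ V ∘ σ - V`. For the maximizing measure `∫ g = 0`, hence `g = V ∘ σ - V` almost everywhere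
(`ae_coboundary_eq`). When `y` is in the support, Poincaré recurrence yields points near `y` that
return near `y` at arbitrarily late times `n`; their Birkhoff sum is `V (σⁿ w) - V w`, which is
small because both points lie in the same cylinder. No ergodicity is needed. Splicing such a return
in front of a segment (`IsNormalized.hasGoodReturns`) shows that the barriers at `x` are bounded
below, and that restricting to segments of length at least `k` does not change the limit as the
cylinder of length `k` shrinks to `y`.

With this restriction, exchanging the end point of a segment for a nearby point does not alter the
first `k` letters, so all the barriers, and their limit `peierls`, satisfy the stated bounds on the
variations of positive index. The variation of index `0` of a coercive potential is infinite.
Calibration holds because only finitely many preimages of a point can precede it in a nearly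
optimal segment.
-/

namespace MarkovShift

variable {A : ℕ → ℕ → Fin 2}

/-! ### Cylinders, orbits and splicing -/

/-- `x` and `y` agree on their first `n` letters, i.e. they lie in a common cylinder of length
`n`. -/
def Agree (n : ℕ) (x y : MarkovShift A) : Prop :=
  ∀ i < n, x.1 i = y.1 i

lemma Agree.symm {n : ℕ} {x y : MarkovShift A} (h : Agree n x y) : Agree n y x :=
  fun i hi => (h i hi).symm

lemma Agree.trans {n : ℕ} {x y z : MarkovShift A} (h : Agree n x y) (h' : Agree n y z) :
    Agree n x z :=
  fun i hi => (h i hi).trans (h' i hi)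

lemma Agree.mono {k n : ℕ} {x y : MarkovShift A} (h : Agree n x y) (hk : k ≤ n) : Agree k x y :=
  fun i hi => h i (hi.trans_le hk)

lemma agree_one_iff {x y : MarkovShift A} : Agree 1 x y ↔ x.1 0 = y.1 0 := by
  simp [Agree]

lemma shift_iterate_apply (n i : ℕ) (x : MarkovShift A) : (shift^[n] x).1 i = x.1 (i + n) := by
  induction n generalizing x with
  | zero => rfl
  | succ n ih => rw [Function.iterate_succ_apply, ih]; rfl

lemma Agree.shift_iterate {n p : ℕ} {x y : MarkovShift A} (h : Agree (n + p) x y) :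
    Agree p (shift^[n] x) (shift^[n] y) := fun i hi => by
  rw [shift_iterate_apply, shift_iterate_apply]
  exact h _ (by omega)

lemma shiftDist_le_pow_iff {lam : ℝ} (h0 : 0 < lam) (h1 : lam < 1) {n : ℕ} {x y : MarkovShift A} :
    shiftDist lam x y ≤ lam ^ n ↔ Agree n x y := by
  unfold shiftDist
  split_ifs with hxy
  · subst hxy
    exact ⟨fun _ i _ => rfl, fun _ => (pow_pos h0 n).le⟩
  · have hne : {j : ℕ | x.1 j ≠ y.1 j}.Nonempty := by
      by_contra hcon
      refine hxy (Subtype.ext (funext fun j => ?_))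
      by_contra hj
      exact hcon ⟨j, hj⟩
    rw [pow_le_pow_iff_right_of_lt_one₀ h0 h1]
    constructor
    · intro hn i hi
      by_contra hcon
      exact (hn.trans (Nat.sInf_le (show i ∈ {j : ℕ | x.1 j ≠ y.1 j} from hcon))).not_gt hi
    · intro h
      refine le_csInf hne fun j hj => ?_
      by_contra hcon
      exact hj (h j (by omega))

/-- The point `z₀ … z_{n-1} x₀ x₁ …` obtained by putting the first `n` letters of `z` in front of
`x`; it is admissible because `zₙ = x₀`. -/
def splice (n : ℕ) (z x : MarkovShift A) (h : z.1 n = x.1 0) : MarkovShift A :=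
  ⟨fun i => if i < n then z.1 i else x.1 (i - n), fun i => by
    rcases lt_trichotomy (i + 1) n with hi | hi | hi
    · simpa [hi, show i < n by omega] using z.2 i
    · subst hi
      simpa [← h] using z.2 i
    · have := x.2 (i - n)
      simpa [show ¬ i < n by omega, show ¬ i + 1 < n by omega,
        show i + 1 - n = i - n + 1 by omega] using this⟩

lemma shift_iterate_splice {n : ℕ} {z x : MarkovShift A} (h : z.1 n = x.1 0) :
    shift^[n] (splice n z x h) = x := by
  refine Subtype.ext (funext fun i => ?_)
  rw [shift_iterate_apply]
  simp [splice]

lemma agree_splice {n p : ℕ} {z x : MarkovShift A} (h : z.1 n = x.1 0)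
    (hp : Agree p (shift^[n] z) x) : Agree (n + p) z (splice n z x h) := by
  intro i hi
  by_cases hin : i < n
  · simp [splice, hin]
  · have := hp (i - n) (by omega)
    rw [shift_iterate_apply] at this
    simpa [splice, hin, show i - n + n = i by omega] using this

lemma agree_one_shift_iterate {n : ℕ} {z x : MarkovShift A} (h : z.1 n = x.1 0) :
    Agree 1 (shift^[n] z) x := by
  rw [agree_one_iff, shift_iterate_apply, zero_add, h]

lemma IsTransitive.exists_path (hA : IsTransitive A) (i j : ℕ) :
    ∃ (n : ℕ) (u : MarkovShift A), u.1 0 = i ∧ u.1 n = j := by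
  obtain ⟨n, u, hu, hi⟩ := hA i j
  refine ⟨n, u, hi, ?_⟩
  have : (shift^[n] u).1 0 = j := hu
  rwa [shift_iterate_apply, zero_add] at this

/-- The periodic point that repeats the first `n` letters of `x`; it is admissible because
`xₙ = x₀`. -/
def periodize (n : ℕ) (hn : 0 < n) (x : MarkovShift A) (h : x.1 n = x.1 0) : MarkovShift A :=
  ⟨fun i => x.1 (i % n), fun i => by
    have hi := Nat.mod_lt i hn
    have hx := x.2 (i % n)
    change A (x.1 (i % n)) (x.1 ((i + 1) % n)) = 1
    rw [← Nat.mod_add_mod]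
    rcases Nat.lt_or_ge (i % n + 1) n with hlt | hge
    · rwa [Nat.mod_eq_of_lt hlt]
    · have heq : i % n + 1 = n := by omega
      rw [heq, h] at hx
      rwa [heq, Nat.mod_self]⟩

lemma shift_iterate_periodize {n : ℕ} (hn : 0 < n) {x : MarkovShift A} (h : x.1 n = x.1 0) :
    shift^[n] (periodize n hn x h) = periodize n hn x h := by
  refine Subtype.ext (funext fun i => ?_)
  rw [shift_iterate_apply]
  simp [periodize]

lemma agree_periodize {n : ℕ} (hn : 0 < n) {x : MarkovShift A} (h : x.1 n = x.1 0) :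
    Agree (n + 1) x (periodize n hn x h) := by
  intro i hi
  rcases Nat.lt_or_ge i n with hlt | hge
  · simp [periodize, Nat.mod_eq_of_lt hlt]
  · obtain rfl : i = n := by omega
    simp [periodize, h]

lemma eventually_agree (n : ℕ) (x : MarkovShift A) : ∀ᶠ y in 𝓝 x, Agree n y x := by
  have h : ∀ i, ∀ᶠ y in 𝓝 x, y.1 i = x.1 i := fun i => by
    have hc : Continuous fun y : MarkovShift A => y.1 i :=
      (continuous_apply i).comp continuous_subtype_val
    exact hc.continuousAt.eventually (p := fun j => j = x.1 i) (by simp)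
  exact (Set.finite_lt_nat n).eventually_all.2 fun i _ => h i

lemma continuous_shift : Continuous (shift : MarkovShift A → MarkovShift A) :=
  Continuous.subtype_mk (f := fun (x : MarkovShift A) j => x.1 (j + 1))
    (continuous_pi fun j => (continuous_apply (j + 1)).comp continuous_subtype_val) _

/-! ### Functions of summable variation -/

/-- The tail `∑_{j ≥ n} v j`. -/
noncomputable def tail (v : ℕ → ℝ) (n : ℕ) : ℝ := ∑' j, v (n + j)

/-- The sequence `v` is summable and bounds the variations of `g` from index `1` on. Nothing is
required of the variation of index `0`, which is infinite for a coercive function. -/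
structure HasSummableModulus (g : MarkovShift A → ℝ) (v : ℕ → ℝ) : Prop where
  nonneg : ∀ n, 0 ≤ v n
  summable : Summable v
  bound : ∀ n, 1 ≤ n → ∀ x y, Agree n x y → |g x - g y| ≤ v n

lemma tendsto_tail {v : ℕ → ℝ} : Tendsto (tail v) atTop (𝓝 0) := by
  have h := _root_.tendsto_sum_nat_add v
  simp only [add_comm] at h
  exact h

namespace HasSummableModulus

variable {g : MarkovShift A → ℝ} {v : ℕ → ℝ}

lemma tail_nonneg (hg : HasSummableModulus g v) (n : ℕ) : 0 ≤ tail v n :=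
  tsum_nonneg fun _ => hg.nonneg _

lemma tail_eq_add (hg : HasSummableModulus g v) (n : ℕ) : tail v n = v n + tail v (n + 1) := by
  have h : Summable fun j => v (n + j) := by
    simpa only [add_comm] using (summable_nat_add_iff n).2 hg.summable
  unfold tail
  rw [h.tsum_eq_zero_add]
  simp only [add_zero, add_assoc, add_comm 1]

lemma tail_anti (hg : HasSummableModulus g v) : Antitone (tail v) :=
  antitone_nat_of_succ_le fun n => by linarith [hg.tail_eq_add n, hg.nonneg n]

/-- Bounded distortion of Birkhoff sums: along `n` steps, points that agree on `n + p` letters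
accumulate at most the variations of index `> p`. -/
lemma birkhoffSum_sub_le (hg : HasSummableModulus g v) {n p : ℕ} (hp : 1 ≤ p)
    {x y : MarkovShift A} (h : Agree (n + p) x y) :
    birkhoffSum shift g n x - birkhoffSum shift g n y ≤ tail v p := by
  suffices H : birkhoffSum shift g n x - birkhoffSum shift g n y ≤ tail v p - tail v (n + p) by
    linarith [hg.tail_nonneg (n + p)]
  induction n generalizing x y with
  | zero => simp
  | succ n ih =>
    have h1 := ih (Agree.shift_iterate (n := 1) (by rwa [← add_assoc, add_comm 1 n]))
    have h2 := (le_abs_self _).trans (hg.bound _ (by omega) x y (h.mono (show n + p ≤ _ by omega)))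
    have h3 := hg.tail_eq_add (n + p)
    rw [birkhoffSum_succ', birkhoffSum_succ']
    rw [show n + 1 + p = n + p + 1 by omega]
    simp only [Function.iterate_one] at h1
    linarith

end HasSummableModulus

lemma continuous_of_modulus {F : MarkovShift A → ℝ} {t : ℕ → ℝ} (ht : Tendsto t atTop (𝓝 0))
    (hF : ∀ n, 1 ≤ n → ∀ x y, Agree n x y → F x ≤ F y + t n) : Continuous F := by
  refine continuous_iff_continuousAt.2 fun x => Metric.tendsto_nhds.2 fun ε hε => ?_
  obtain ⟨n, hn, hn1⟩ := ((ht.eventually_lt_const hε).and (eventually_ge_atTop 1)).exists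
  filter_upwards [eventually_agree n x] with y hy
  rw [Real.dist_eq, abs_lt]
  constructor <;> linarith [hF n hn1 x y hy.symm, hF n hn1 y x hy]

/-- A function with a summable modulus that is negative on all but finitely many letters is bounded
above, because it is bounded on each single letter. -/
lemma HasSummableModulus.exists_le {g : MarkovShift A → ℝ} {v : ℕ → ℝ} (hA : IsTransitive A)
    (hg : HasSummableModulus g v) (hneg : ∃ J : ℕ, ∀ x : MarkovShift A, J ≤ x.1 0 → g x < 0) :
    ∃ B, ∀ x, g x ≤ B := by
  obtain ⟨J, hJ⟩ := hneg
  choose l u hu _ using fun i => hA.exists_path i 0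
  obtain ⟨B, hB⟩ := ((Finset.range J).image fun i => g (u i) + v 1).bddAbove
  refine ⟨max B 0, fun x => ?_⟩
  rcases Nat.lt_or_ge (x.1 0) J with hx | hx
  · have h1 := hB (Finset.mem_coe.2 (Finset.mem_image_of_mem _ (Finset.mem_range.2 hx)))
    have h2 := hg.bound 1 le_rfl x (u (x.1 0)) (agree_one_iff.2 (hu _).symm)
    linarith [le_max_left B 0, (abs_le.1 h2).2]
  · exact (hJ x hx).le.trans (le_max_right _ _)

/-! ### Sums along orbit segments that start near a given point -/

/-- The properties of `g = f - m(f)` that the construction of the barrier uses: summable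
variations, Birkhoff sums bounded above along closed words, and coercivity. -/
structure IsNormalized (g : MarkovShift A → ℝ) (v : ℕ → ℝ) : Prop extends
    HasSummableModulus g v where
  birkhoffSum_le_of_closed :
    ∀ (n : ℕ) (x : MarkovShift A), x.1 n = x.1 0 → birkhoffSum shift g n x ≤ tail v 1
  coercive : ∀ c : ℝ, ∃ J : ℕ, ∀ x : MarkovShift A, J ≤ x.1 0 → g x < c

/-- The Birkhoff sums of `g` along the orbit segments of length at least `N` that start in the
cylinder of length `k` around `y` and end at `x`. -/
def arrivalSums (g : MarkovShift A → ℝ) (y : MarkovShift A) (k N : ℕ) (x : MarkovShift A) : Set ℝ :=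
  {t | ∃ (n : ℕ) (z : MarkovShift A), N ≤ n ∧ Agree k y z ∧ shift^[n] z = x ∧
    birkhoffSum shift g n z = t}

/-- The supremum of the sums in `arrivalSums`. -/
noncomputable def barrier (g : MarkovShift A → ℝ) (y : MarkovShift A) (k N : ℕ)
    (x : MarkovShift A) : ℝ :=
  sSup (arrivalSums g y k N x)

lemma arrivalSums_mono {g : MarkovShift A → ℝ} {y x : MarkovShift A} {k k' N N' : ℕ} (hk : k ≤ k')
    (hN : N ≤ N') : arrivalSums g y k' N' x ⊆ arrivalSums g y k N x := by
  rintro t ⟨n, z, hn, hz, hx, rfl⟩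
  exact ⟨n, z, hN.trans hn, hz.mono hk, hx, rfl⟩

lemma arrivalSums_shift {g : MarkovShift A → ℝ} {y x : MarkovShift A} {k N : ℕ} {t : ℝ}
    (ht : t ∈ arrivalSums g y k N x) : t + g x ∈ arrivalSums g y k N (shift x) := by
  obtain ⟨n, z, hn, hz, rfl, rfl⟩ := ht
  exact ⟨n + 1, z, by omega, hz, Function.iterate_succ_apply' _ _ _, birkhoffSum_succ _ _ _ _⟩

/-- The last letter of an orbit segment can be split off. -/
lemma exists_of_mem_arrivalSums_succ {g : MarkovShift A → ℝ} {y x : MarkovShift A} {k : ℕ} {t : ℝ}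
    (ht : t ∈ arrivalSums g y (k + 1) (k + 1) x) :
    ∃ w, shift w = x ∧ t - g w ∈ arrivalSums g y k k w := by
  obtain ⟨n, z, hn, hz, rfl, rfl⟩ := ht
  obtain ⟨n, rfl⟩ := Nat.exists_eq_succ_of_ne_zero (show n ≠ 0 by omega)
  refine ⟨shift^[n] z, (Function.iterate_succ_apply' _ _ _).symm, n, z, by omega,
    hz.mono (by omega), rfl, ?_⟩
  rw [birkhoffSum_succ, add_sub_cancel_right]

/-- Exchanging the end point for a nearby one. The condition `k ≤ N + 1` keeps the new segment in
the cylinder of length `k` around `y`. -/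
lemma HasSummableModulus.exists_arrivalSums_le {g : MarkovShift A → ℝ} {v : ℕ → ℝ}
    (hg : HasSummableModulus g v) {y x x' : MarkovShift A} {k N p : ℕ} (hk : k ≤ N + 1)
    (hp : 1 ≤ p) (h : Agree p x x') {t : ℝ} (ht : t ∈ arrivalSums g y k N x) :
    ∃ t' ∈ arrivalSums g y k N x', t ≤ t' + tail v p := by
  obtain ⟨n, z, hn, hz, rfl, rfl⟩ := ht
  have hz0 : z.1 n = x'.1 0 := by
    have := h 0 (by omega)
    rwa [shift_iterate_apply, zero_add] at this
  have hag := agree_splice hz0 h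
  exact ⟨_, ⟨n, splice n z x' hz0, hn, hz.trans (hag.mono (by omega)), shift_iterate_splice _, rfl⟩,
    by linarith [hg.birkhoffSum_sub_le hp hag]⟩

namespace IsNormalized

variable {g : MarkovShift A → ℝ} {v : ℕ → ℝ}

/-- Orbit segments that start in a fixed letter have Birkhoff sums bounded above, uniformly in the
end point. A segment whose last step is in a small letter is compared with a closed word; the
remaining letters contribute negative amounts. -/
lemma exists_birkhoffSum_le (hA : IsTransitive A) (hg : IsNormalized g v) (a : ℕ) :
    ∃ K : ℝ, ∀ (n : ℕ) (z : MarkovShift A), z.1 0 = a → birkhoffSum shift g n z ≤ K := by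
  obtain ⟨B, hB⟩ := hg.exists_le hA (hg.coercive 0)
  obtain ⟨J, hJ⟩ := hg.coercive 0
  choose l u hu hl using fun b => hA.exists_path b a
  obtain ⟨K, hK⟩ := ((Finset.range J).image fun b =>
    2 * tail v 1 - birkhoffSum shift g (l b) (u b) + B).bddAbove
  have hclose : ∀ (n : ℕ) (z : MarkovShift A), z.1 0 = a →
      birkhoffSum shift g n z ≤
        2 * tail v 1 - birkhoffSum shift g (l (z.1 n)) (u (z.1 n)) := by
    intro n z hz
    have hn : z.1 n = (u (z.1 n)).1 0 := (hu _).symm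
    have hag := agree_splice hn (agree_one_shift_iterate hn)
    have hit := shift_iterate_splice hn
    set q := splice n z (u (z.1 n)) hn
    have hq0 : q.1 0 = a := (hag 0 (by omega)).symm.trans hz
    have hql : q.1 (n + l (z.1 n)) = a := by
      rw [add_comm, ← shift_iterate_apply, hit, hl]
    have h1 := hg.birkhoffSum_le_of_closed _ q (hql.trans hq0.symm)
    rw [birkhoffSum_add, hit] at h1
    linarith [hg.birkhoffSum_sub_le le_rfl hag]
  refine ⟨max K 0, fun n z hz => ?_⟩
  induction n with
  | zero => simp
  | succ n ih =>
    rw [birkhoffSum_succ]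
    rcases Nat.lt_or_ge (z.1 n) J with hx | hx
    · have h1 := hK (Finset.mem_coe.2 (Finset.mem_image_of_mem _ (Finset.mem_range.2 hx)))
      linarith [hclose n z hz, hB (shift^[n] z), le_max_left K 0]
    · have := hJ (shift^[n] z) (by rwa [shift_iterate_apply, zero_add])
      linarith

lemma exists_mem_upperBounds (hA : IsTransitive A) (hg : IsNormalized g v) (y : MarkovShift A) :
    ∃ K : ℝ, ∀ k N x, 1 ≤ k → K ∈ upperBounds (arrivalSums g y k N x) := by
  obtain ⟨K, hK⟩ := hg.exists_birkhoffSum_le hA (y.1 0)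
  refine ⟨K, fun k N x hk => ?_⟩
  rintro t ⟨n, z, -, hz, -, rfl⟩
  exact hK n z (hz 0 hk).symm

lemma bddAbove_arrivalSums (hA : IsTransitive A) (hg : IsNormalized g v) (y : MarkovShift A)
    {k : ℕ} (hk : 1 ≤ k) (N : ℕ) (x : MarkovShift A) : BddAbove (arrivalSums g y k N x) :=
  (hg.exists_mem_upperBounds hA y).imp fun _ hK => hK k N x hk

lemma nonempty_arrivalSums_one (hA : IsTransitive A) (g : MarkovShift A → ℝ)
    (y x : MarkovShift A) : (arrivalSums g y 1 0 x).Nonempty := by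
  obtain ⟨l, u, hu, hl⟩ := hA.exists_path (y.1 0) (x.1 0)
  have hag := agree_splice hl (agree_one_shift_iterate hl)
  exact ⟨_, l, splice l u x hl, l.zero_le,
    agree_one_iff.2 (hu.symm.trans (hag 0 (by omega))), shift_iterate_splice _, rfl⟩

lemma barrier_le_add_tail (hA : IsTransitive A) (hg : IsNormalized g v) {y x x' : MarkovShift A}
    {k N p : ℕ} (hk1 : 1 ≤ k) (hk : k ≤ N + 1) (hne : (arrivalSums g y k N x).Nonempty)
    (hp : 1 ≤ p) (h : Agree p x x') : barrier g y k N x ≤ barrier g y k N x' + tail v p := by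
  refine csSup_le hne fun t ht => ?_
  obtain ⟨t', ht', hle⟩ := hg.exists_arrivalSums_le hk hp h ht
  exact hle.trans (add_le_add_left (le_csSup (hg.bddAbove_arrivalSums hA y hk1 N x') ht') _)

lemma barrier_add_le_shift (hA : IsTransitive A) (hg : IsNormalized g v) {y x : MarkovShift A}
    {k N : ℕ} (hk : 1 ≤ k) (hne : (arrivalSums g y k N x).Nonempty) :
    barrier g y k N x + g x ≤ barrier g y k N (shift x) := by
  rw [← le_sub_iff_add_le]
  refine csSup_le hne fun t ht => ?_
  rw [le_sub_iff_add_le]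
  exact le_csSup (hg.bddAbove_arrivalSums hA y hk N _) (arrivalSums_shift ht)

end IsNormalized

/-! ### Recurrence with almost optimal Birkhoff sums -/

/-- Let `g ≤ V ∘ T - V` with `V` bounded above and `∫ g ≥ 0`. Then equality holds almost
everywhere. Integrability of `V` is not assumed: the truncations `max V (-M)` have coboundaries of
integral zero, bounded below by `-|g|`, and Fatou's lemma applies as `M → ∞`. -/
lemma ae_coboundary_eq {X : Type*} [MeasurableSpace X] {μ : Measure X} [IsFiniteMeasure μ]
    {T : X → X} (hT : MeasurePreserving T μ μ) {g V : X → ℝ} (hg : Integrable g μ)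
    (hV : Measurable V) {K : ℝ} (hK : ∀ x, V x ≤ K) (hle : ∀ x, g x ≤ V (T x) - V x)
    (hint : 0 ≤ ∫ x, g x ∂μ) : ∀ᵐ x ∂μ, V (T x) - V x = g x := by
  set W : ℕ → X → ℝ := fun M x => max (V x) (-M)
  have hWm : ∀ M, Measurable (W M) := fun M => hV.max measurable_const
  have hWi : ∀ M, Integrable (W M) μ := fun M => by
    refine Integrable.of_bound (C := |K| + M) (hWm M).aestronglyMeasurable (ae_of_all _ fun x => ?_)
    have hM : (0 : ℝ) ≤ M := M.cast_nonneg
    rw [Real.norm_eq_abs, abs_le]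
    exact ⟨by linarith [le_max_right (V x) (-M : ℝ), abs_nonneg K],
      max_le (by linarith [hK x, le_abs_self K]) (by linarith [abs_nonneg K])⟩
  have hWT : ∀ M, Integrable (fun x => W M (T x)) μ := fun M =>
    hT.integrable_comp_of_integrable (hWi M)
  have hWd : ∀ M, Integrable (fun x => W M (T x) - W M x) μ := fun M => (hWT M).sub (hWi M)
  have hWs : ∀ M, Integrable (fun x => W M (T x) - W M x + |g x|) μ := fun M =>
    (hWd M).add hg.abs
  have hW0 : ∀ M, ∫ x, (W M (T x) - W M x + |g x|) ∂μ = ∫ x, |g x| ∂μ := fun M => by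
    have h1 : ∫ x, W M (T x) ∂μ = ∫ x, W M x ∂μ := by
      conv_rhs => rw [← hT.map_eq]
      exact (integral_map hT.aemeasurable (hWm M).aestronglyMeasurable).symm
    rw [integral_add (hWd M) hg.abs, integral_sub (hWT M) (hWi M), h1]
    ring
  have hWpos : ∀ M x, 0 ≤ W M (T x) - W M x + |g x| := fun M x => by
    have h1 := hle x
    have h2 := neg_abs_le (g x)
    have h3 := abs_nonneg (g x)
    simp only [W]
    rcases le_total (V x) (-M) with h | h
    · rw [max_eq_right h]; linarith [le_max_right (V (T x)) (-M : ℝ)]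
    · rw [max_eq_left h]; linarith [le_max_left (V (T x)) (-M : ℝ)]
  have hlim : ∀ x, Tendsto (fun M => ENNReal.ofReal (W M (T x) - W M x + |g x|)) atTop
      (𝓝 (ENNReal.ofReal (V (T x) - V x + |g x|))) := fun x => by
    refine tendsto_const_nhds.congr' ?_
    filter_upwards [tendsto_natCast_atTop_atTop.eventually_ge_atTop (-V x),
      tendsto_natCast_atTop_atTop.eventually_ge_atTop (-V (T x))] with M h1 h2
    simp only [W]
    rw [max_eq_left (by linarith), max_eq_left (by linarith)]
  have hφm : AEStronglyMeasurable (fun x => V (T x) - V x + |g x|) μ :=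
    (((hV.comp hT.measurable).sub hV).aestronglyMeasurable).add hg.abs.aestronglyMeasurable
  have hφ0 : ∀ x, 0 ≤ V (T x) - V x + |g x| := fun x => by linarith [hle x, neg_abs_le (g x)]
  have hfatou : ∫⁻ x, ENNReal.ofReal (V (T x) - V x + |g x|) ∂μ ≤
      ENNReal.ofReal (∫ x, |g x| ∂μ) := by
    calc _ = ∫⁻ x, liminf (fun M => ENNReal.ofReal (W M (T x) - W M x + |g x|)) atTop ∂μ :=
          lintegral_congr fun x => (hlim x).liminf_eq.symm
      _ ≤ liminf (fun M => ∫⁻ x, ENNReal.ofReal (W M (T x) - W M x + |g x|) ∂μ) atTop :=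
          lintegral_liminf_le' fun M =>
            (hWs M).aestronglyMeasurable.aemeasurable.ennreal_ofReal
      _ = ENNReal.ofReal (∫ x, |g x| ∂μ) := by
          have : ∀ M, ∫⁻ x, ENNReal.ofReal (W M (T x) - W M x + |g x|) ∂μ =
              ENNReal.ofReal (∫ x, |g x| ∂μ) := fun M => by
            rw [← ofReal_integral_eq_lintegral_ofReal (hWs M) (ae_of_all _ (hWpos M)), hW0 M]
          simp only [this, liminf_const]
  have hφi : Integrable (fun x => V (T x) - V x + |g x|) μ := by
    refine ⟨hφm, ?_⟩
    rw [hasFiniteIntegral_iff_ofReal (ae_of_all _ hφ0)]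
    exact hfatou.trans_lt ENNReal.ofReal_lt_top
  have hφle : ∫ x, (V (T x) - V x + |g x|) ∂μ ≤ ∫ x, |g x| ∂μ := by
    rw [integral_eq_lintegral_of_nonneg_ae (ae_of_all _ hφ0) hφm]
    exact ENNReal.toReal_le_of_le_ofReal (integral_nonneg fun x => abs_nonneg _) hfatou
  have hφd : Integrable (fun x => V (T x) - V x + |g x| - |g x|) μ := hφi.sub hg.abs
  have hφe : Integrable (fun x => V (T x) - V x + |g x| - |g x| - g x) μ := hφd.sub hg
  have hd : ∫ x, (V (T x) - V x + |g x| - |g x| - g x) ∂μ = 0 := by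
    refine le_antisymm ?_ (integral_nonneg fun x => by simpa using hle x)
    rw [integral_sub hφd hg, integral_sub hφi hg.abs]
    linarith
  rw [integral_eq_zero_iff_of_nonneg (fun x => by simpa using hle x) hφe] at hd
  filter_upwards [hd] with x hx
  simp only [Pi.zero_apply] at hx
  linarith

/-- Every point near `y` is reached by long orbit segments that start near `y` and have a Birkhoff
sum bounded below, the error being controlled by the tails of `v`. -/
def HasGoodReturns (g : MarkovShift A → ℝ) (v : ℕ → ℝ) (y : MarkovShift A) : Prop :=
  ∀ (k p : ℕ) (q : MarkovShift A), 1 ≤ p → p ≤ k → Agree p y q →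
    ∃ (n : ℕ) (z : MarkovShift A), k ≤ n ∧ Agree k y z ∧ shift^[n] z = q ∧
      -(tail v k + tail v p) ≤ birkhoffSum shift g n z

/-- A point of the support of an invariant measure with `∫ g ≥ 0` has good returns. On almost every
orbit, `g` is the coboundary of the subaction `barrier g y 1 0`, so its Birkhoff sum up to a return
time to a cylinder is a difference of two values on that cylinder; Poincaré recurrence provides the
return times. -/
lemma IsNormalized.hasGoodReturns {g : MarkovShift A → ℝ} {v : ℕ → ℝ} (hA : IsTransitive A)
    (hg : IsNormalized g v) {μ : Measure (MarkovShift A)} (hμ : IsInvariantProb μ)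
    (hi : Integrable g μ) (hint : 0 ≤ ∫ x, g x ∂μ) {y : MarkovShift A} (hy : y ∈ μ.support) :
    HasGoodReturns g v y := by
  intro k p q hp hpk hq
  have hk : 1 ≤ k := hp.trans hpk
  obtain ⟨hprob, hT⟩ := hμ
  set V := barrier g y 1 0
  have hVmod : ∀ n, 1 ≤ n → ∀ x x', Agree n x x' → V x ≤ V x' + tail v n := fun n hn x x' h =>
    hg.barrier_le_add_tail hA le_rfl (by omega) (nonempty_arrivalSums_one hA g y x) hn h
  have hVm : Measurable V := (continuous_of_modulus tendsto_tail hVmod).measurable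
  obtain ⟨K, hK⟩ := hg.exists_mem_upperBounds hA y
  have hcob : ∀ᵐ w ∂μ, V (shift w) - V w = g w :=
    ae_coboundary_eq hT hi hVm
      (fun x => csSup_le (nonempty_arrivalSums_one hA g y x) (hK 1 0 x le_rfl))
      (fun x => by
        linarith [hg.barrier_add_le_shift hA le_rfl (nonempty_arrivalSums_one hA g y x)]) hint
  have hcob' : ∀ᵐ w ∂μ, ∀ n, V (shift (shift^[n] w)) - V (shift^[n] w) = g (shift^[n] w) :=
    ae_all_iff.2 fun n => (hT.iterate n).quasiMeasurePreserving.ae hcob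
  obtain ⟨U, hU, hUo, hyU⟩ := mem_nhds_iff.1 (eventually_agree k y)
  have hpos : μ U ≠ 0 := ((Measure.mem_support_iff_forall y).1 hy U (hUo.mem_nhds hyU)).ne'
  obtain ⟨w, ⟨hwU, hwr⟩, hw⟩ := ((hT.conservative.frequently_ae_mem_and_frequently_image_mem
    hUo.measurableSet.nullMeasurableSet hpos).and_eventually hcob').exists
  obtain ⟨n, hnU, hn⟩ := (hwr.and_eventually (eventually_ge_atTop k)).exists
  have hsum : birkhoffSum shift g n w = V (shift^[n] w) - V w := by
    refine (Finset.sum_congr rfl fun j _ => ?_).trans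
      (Finset.sum_range_sub (fun j => V (shift^[j] w)) n)
    rw [← hw j, Function.iterate_succ_apply']
  have hyw : Agree k y w := (hU hwU).symm
  have hyn : Agree k y (shift^[n] w) := (hU hnU).symm
  have hpq : Agree p (shift^[n] w) q := (hyn.mono hpk).symm.trans hq
  have h0 : w.1 n = q.1 0 := by
    have := hpq 0 (by omega)
    rwa [shift_iterate_apply, zero_add] at this
  have hag := agree_splice h0 hpq
  refine ⟨n, splice n w q h0, hn, hyw.trans (hag.mono (by omega)), shift_iterate_splice _, ?_⟩
  linarith [hg.birkhoffSum_sub_le hp hag, hVmod k hk w _ (hyw.symm.trans hyn)]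

/-! ### The Peierls barrier as a limit of barriers -/

/-- The Peierls barrier, obtained from orbit segments whose length exceeds the length of the
cylinder around `y` in which they start. Short segments would interfere with the exchange of end
points; under `HasGoodReturns` leaving them out does not change the limit. -/
noncomputable def peierls (g : MarkovShift A → ℝ) (y x : MarkovShift A) : ℝ :=
  ⨅ k, barrier g y (k + 1) (k + 1) x

namespace IsNormalized

variable {g : MarkovShift A → ℝ} {v : ℕ → ℝ} {y : MarkovShift A}

/-- The sums defining the barriers at `x` do not tend to `-∞`: take a good return to a fixed path
that leads from the first letter of `y` to `x`. -/
lemma exists_forall_le_arrivalSums (hA : IsTransitive A) (hg : IsNormalized g v)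
    (hr : HasGoodReturns g v y) (x : MarkovShift A) :
    ∃ L : ℝ, ∀ k, 1 ≤ k → ∃ t ∈ arrivalSums g y k k x, L ≤ t := by
  obtain ⟨t, l, q, -, hq, hx, rfl⟩ := nonempty_arrivalSums_one hA g y x
  refine ⟨birkhoffSum shift g l q - 2 * tail v 1, fun k hk => ?_⟩
  obtain ⟨n, z, hn, hz, hzq, hle⟩ := hr k 1 q le_rfl hk hq
  refine ⟨_, ⟨n + l, z, by omega, hz, ?_, rfl⟩, ?_⟩
  · rw [add_comm, Function.iterate_add_apply, hzq, hx]
  · rw [birkhoffSum_add, hzq]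
    linarith [hg.tail_anti hk]

lemma nonempty_arrivalSums (hA : IsTransitive A) (hg : IsNormalized g v)
    (hr : HasGoodReturns g v y) {k : ℕ} (hk : 1 ≤ k) (x : MarkovShift A) :
    (arrivalSums g y k k x).Nonempty := by
  obtain ⟨L, hL⟩ := hg.exists_forall_le_arrivalSums hA hr x
  obtain ⟨t, ht, -⟩ := hL k hk
  exact ⟨t, ht⟩

lemma bddBelow_barrier (hA : IsTransitive A) (hg : IsNormalized g v)
    (hr : HasGoodReturns g v y) (x : MarkovShift A) :
    BddBelow (Set.range fun k => barrier g y (k + 1) (k + 1) x) := by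
  obtain ⟨L, hL⟩ := hg.exists_forall_le_arrivalSums hA hr x
  refine ⟨L, ?_⟩
  rintro _ ⟨k, rfl⟩
  obtain ⟨t, ht, hle⟩ := hL (k + 1) (by omega)
  exact hle.trans (le_csSup (hg.bddAbove_arrivalSums hA y (by omega) _ x) ht)

lemma peierls_le_barrier (hA : IsTransitive A) (hg : IsNormalized g v)
    (hr : HasGoodReturns g v y) {k : ℕ} (hk : 1 ≤ k) (x : MarkovShift A) :
    peierls g y x ≤ barrier g y k k x := by
  obtain ⟨k, rfl⟩ := Nat.exists_eq_add_of_le' hk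
  exact ciInf_le (hg.bddBelow_barrier hA hr x) k

lemma tendsto_barrier (hA : IsTransitive A) (hg : IsNormalized g v)
    (hr : HasGoodReturns g v y) (x : MarkovShift A) :
    Tendsto (fun k => barrier g y k k x) atTop (𝓝 (peierls g y x)) := by
  rw [← tendsto_add_atTop_iff_nat 1]
  refine tendsto_atTop_ciInf (antitone_nat_of_succ_le fun k => ?_) (hg.bddBelow_barrier hA hr x)
  exact csSup_le_csSup (hg.bddAbove_arrivalSums hA y (by omega) _ x)
    (hg.nonempty_arrivalSums hA hr (by omega) x) (arrivalSums_mono (by omega) (by omega))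

/-- Segments of arbitrary length contribute at most a vanishing amount more than the long ones,
since a good return can be put in front of them. -/
lemma le_barrier_add_tail (hA : IsTransitive A) (hg : IsNormalized g v)
    (hr : HasGoodReturns g v y) {k : ℕ} (hk : 1 ≤ k) {x : MarkovShift A} {t : ℝ}
    (ht : t ∈ arrivalSums g y k 0 x) : t ≤ barrier g y k k x + 2 * tail v k := by
  obtain ⟨l, q, -, hq, hx, rfl⟩ := ht
  obtain ⟨n, z, hn, hz, hzq, hle⟩ := hr k k q hk le_rfl hq
  have hmem : birkhoffSum shift g (n + l) z ∈ arrivalSums g y k k x :=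
    ⟨n + l, z, by omega, hz, by rw [add_comm, Function.iterate_add_apply, hzq, hx], rfl⟩
  have := le_csSup (hg.bddAbove_arrivalSums hA y hk k x) hmem
  rw [birkhoffSum_add, hzq] at this
  unfold barrier
  linarith

lemma peierls_add_le_shift (hA : IsTransitive A) (hg : IsNormalized g v)
    (hr : HasGoodReturns g v y) (x : MarkovShift A) :
    peierls g y x + g x ≤ peierls g y (shift x) := by
  refine le_of_tendsto_of_tendsto ((hg.tendsto_barrier hA hr x).add_const (g x))
    (hg.tendsto_barrier hA hr (shift x)) ?_
  filter_upwards [eventually_ge_atTop 1] with k hk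
  exact hg.barrier_add_le_shift hA hk (hg.nonempty_arrivalSums hA hr hk x)

lemma peierls_le_add_tail (hA : IsTransitive A) (hg : IsNormalized g v)
    (hr : HasGoodReturns g v y) {p : ℕ} (hp : 1 ≤ p) {x x' : MarkovShift A} (h : Agree p x x') :
    peierls g y x ≤ peierls g y x' + tail v p := by
  refine le_of_tendsto_of_tendsto (hg.tendsto_barrier hA hr x)
    ((hg.tendsto_barrier hA hr x').add_const (tail v p)) ?_
  filter_upwards [eventually_ge_atTop 1] with k hk
  exact hg.barrier_le_add_tail hA hk k.le_succ (hg.nonempty_arrivalSums hA hr hk x) hp h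

lemma exists_peierls_le (hA : IsTransitive A) (hg : IsNormalized g v)
    (hr : HasGoodReturns g v y) : ∃ K : ℝ, ∀ x, peierls g y x ≤ K := by
  obtain ⟨K, hK⟩ := hg.exists_mem_upperBounds hA y
  exact ⟨K, fun x => (hg.peierls_le_barrier hA hr le_rfl x).trans
    (csSup_le (hg.nonempty_arrivalSums hA hr le_rfl x) (hK 1 1 x le_rfl))⟩

/-- Calibration. By coercivity only finitely many preimages of `x` can end a nearly optimal
segment; if none of them were calibrated, a barrier at `x` would lie below its infimum. -/
lemma exists_shift_eq (hA : IsTransitive A) (hg : IsNormalized g v)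
    (hr : HasGoodReturns g v y) (x : MarkovShift A) :
    ∃ w, shift w = x ∧ peierls g y w + g w = peierls g y x := by
  by_contra! hcon
  have hlt : ∀ w, shift w = x → peierls g y w + g w < peierls g y x := fun w hw =>
    lt_of_le_of_ne (hw ▸ hg.peierls_add_le_shift hA hr w) (hcon w hw)
  obtain ⟨K, hK⟩ := hg.exists_mem_upperBounds hA y
  obtain ⟨J, hJ⟩ := hg.coercive (peierls g y x - 1 - K)
  have hev : ∀ᶠ k : ℕ in atTop, ∀ a ∈ Finset.range J, ∀ w, shift w = x → w.1 0 = a →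
      barrier g y k k w + g w + 1 / ((k : ℝ) + 1) < peierls g y x := by
    refine (Filter.eventually_all_finset _).2 fun a _ => ?_
    by_cases hex : ∃ w, shift w = x ∧ w.1 0 = a
    · obtain ⟨w, hw, hwa⟩ := hex
      have hlim := ((hg.tendsto_barrier hA hr w).add_const (g w)).add
        (tendsto_one_div_add_atTop_nhds_zero_nat (𝕜 := ℝ))
      rw [add_zero] at hlim
      filter_upwards [hlim.eventually_lt_const (hlt w hw)] with k hk w' hw' hwa'
      -- A preimage is determined by its first letter.
      obtain rfl : w' = w := by
        refine Subtype.ext (funext fun i => ?_)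
        cases i with
        | zero => rw [hwa, hwa']
        | succ i => exact congrFun (congrArg Subtype.val (hw'.trans hw.symm)) i
      exact hk
    · exact Eventually.of_forall fun k w hw hwa => absurd ⟨w, hw, hwa⟩ hex
  obtain ⟨k, hk, hk1⟩ := (hev.and (eventually_ge_atTop 1)).exists
  have hδ : 0 < 1 / ((k : ℝ) + 1) := by positivity
  have hδ1 : 1 / ((k : ℝ) + 1) ≤ 1 := by
    rw [div_le_one (by positivity)]
    linarith [(Nat.cast_nonneg k : (0 : ℝ) ≤ k)]
  have hlt' : peierls g y x - 1 / ((k : ℝ) + 1) < barrier g y (k + 1) (k + 1) x := by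
    linarith [hg.peierls_le_barrier hA hr (show 1 ≤ k + 1 by omega) x]
  obtain ⟨t, ht, hlt''⟩ :=
    exists_lt_of_lt_csSup (hg.nonempty_arrivalSums hA hr (by omega) x) hlt'
  obtain ⟨w, hw, htw⟩ := exists_of_mem_arrivalSums_succ ht
  rcases Nat.lt_or_ge (w.1 0) J with hwJ | hwJ
  · have h1 := hk _ (Finset.mem_range.2 hwJ) w hw rfl
    have h2 : t - g w ≤ barrier g y k k w :=
      le_csSup (hg.bddAbove_arrivalSums hA y hk1 k w) htw
    linarith
  · linarith [hJ w hwJ, hK k k w hk1 htw]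

end IsNormalized

/-! ### Normalization of a coercive potential of bounded variation -/

/-- The invariant probability measure equidistributed on a periodic orbit. -/
lemma exists_isInvariantProb_integral {n : ℕ} (hn : 0 < n) {p : MarkovShift A}
    (hp : shift^[n] p = p) (f : MarkovShift A → ℝ) :
    ∃ μ : Measure (MarkovShift A), IsInvariantProb μ ∧ Integrable f μ ∧
      ∫ x, f x ∂μ = birkhoffSum shift f n p / n := by
  have hn0 : (n : ℝ≥0∞) ≠ 0 := by exact_mod_cast hn.ne'
  have hi : ∀ j ∈ Finset.range n, Integrable f (Measure.dirac (shift^[j] p)) := fun j _ =>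
    integrable_dirac enorm_lt_top
  refine ⟨(n : ℝ≥0∞)⁻¹ • ∑ j ∈ Finset.range n, Measure.dirac (shift^[j] p), ⟨⟨?_⟩, ?_⟩, ?_, ?_⟩
  · simp [ENNReal.inv_mul_cancel hn0 (ENNReal.natCast_ne_top n)]
  · refine ⟨continuous_shift.measurable, Measure.ext fun s hs => ?_⟩
    rw [Measure.map_apply continuous_shift.measurable hs]
    simp only [Measure.smul_apply, Measure.finsetSum_apply]
    congr 1
    have h1 : ∀ j, Measure.dirac (shift^[j] p) (shift ⁻¹' s) =
        Measure.dirac (shift^[j + 1] p) s := fun j => by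
      rw [Measure.dirac_apply' _ hs, Measure.dirac_apply' _ (continuous_shift.measurable hs),
        Function.iterate_succ_apply']
      rfl
    simp only [h1]
    have h2 := Finset.sum_range_succ (fun j => Measure.dirac (shift^[j] p) s) n
    rw [Finset.sum_range_succ'] at h2
    simp only [hp, Function.iterate_zero, id] at h2
    exact (ENNReal.add_left_inj (measure_ne_top _ s)).1 h2
  · exact (integrable_finsetSum_measure.2 hi).smul_measure (ENNReal.inv_ne_top.2 hn0)
  · rw [integral_smul_measure, integral_finsetSum_measure hi]
    simp [birkhoffSum, integral_dirac, div_eq_inv_mul]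

lemma IsCoercive.exists_forall_lt {f : MarkovShift A → ℝ} (hf : IsCoercive f) (c : ℝ) :
    ∃ J : ℕ, ∀ x : MarkovShift A, J ≤ x.1 0 → f x < c := by
  obtain ⟨J, hJ⟩ := eventually_atTop.1 (hf.eventually_lt_const (EReal.bot_lt_coe c))
  refine ⟨J, fun x hx => EReal.coe_lt_coe_iff.1 (lt_of_le_of_lt ?_ (hJ _ hx))⟩
  exact le_iSup₂_of_le x (show x ∈ letterCylinder A (x.1 0) from rfl) le_rfl

variable {lam : ℝ} {f : MarkovShift A → ℝ}

lemma HasBoundedVariation.variation_ne_top (hfv : HasBoundedVariation lam f) {n : ℕ}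
    (hn : 1 ≤ n) : variation lam f n ≠ ∞ := by
  obtain ⟨n, rfl⟩ := Nat.exists_eq_add_of_le' hn
  exact ENNReal.ne_top_of_tsum_ne_top hfv.ne n

lemma HasBoundedVariation.hasSummableModulus (h0 : 0 < lam) (h1 : lam < 1)
    (hfv : HasBoundedVariation lam f) :
    HasSummableModulus f fun n => (variation lam f n).toReal where
  nonneg n := ENNReal.toReal_nonneg
  summable := (summable_nat_add_iff 1).1 (ENNReal.summable_toReal hfv.ne)
  bound n hn x y h := by
    refine (ENNReal.ofReal_le_iff_le_toReal (hfv.variation_ne_top hn)).1 ?_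
    exact le_iSup_of_le x (le_iSup₂_of_le y ((shiftDist_le_pow_iff h0 h1).2 h) le_rfl)

lemma HasBoundedVariation.ofReal_tail (hfv : HasBoundedVariation lam f) {n : ℕ} (hn : 1 ≤ n) :
    ENNReal.ofReal (tail (fun n => (variation lam f n).toReal) n) =
      ∑' j, variation lam f (n + j) := by
  have hs : Summable fun n => (variation lam f n).toReal :=
    (summable_nat_add_iff 1).1 (ENNReal.summable_toReal hfv.ne)
  rw [tail, ENNReal.ofReal_tsum_of_nonneg (fun _ => ENNReal.toReal_nonneg)
    (by simpa only [add_comm] using (summable_nat_add_iff n).2 hs)]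
  exact tsum_congr fun j => ENNReal.ofReal_toReal (hfv.variation_ne_top (by omega))

/-- A coercive potential has infinite variation of index `0`, since every letter occurs and it is
therefore unbounded below. -/
lemma IsCoercive.variation_zero (hA : IsTransitive A) (h0 : 0 < lam) (h1 : lam < 1)
    (hf : IsCoercive f) : variation lam f 0 = ∞ := by
  refine ENNReal.eq_top_of_forall_nnreal_le fun r => ?_
  obtain ⟨-, x, -, -⟩ := hA.exists_path 0 0
  obtain ⟨J, hJ⟩ := hf.exists_forall_lt (f x - r)
  obtain ⟨-, y, hy, -⟩ := hA.exists_path J J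
  have hxy : (r : ℝ) ≤ |f x - f y| := by
    linarith [hJ y hy.ge, le_abs_self (f x - f y)]
  have hag : Agree 0 x y := fun i hi => absurd hi (Nat.not_lt_zero i)
  refine le_iSup_of_le x (le_iSup₂_of_le y ((shiftDist_le_pow_iff h0 h1).2 hag) ?_)
  rw [← ENNReal.ofReal_coe_nnreal]
  exact ENNReal.ofReal_le_ofReal hxy

lemma birkhoffSum_sub_const (c : ℝ) (n : ℕ) (x : MarkovShift A) :
    birkhoffSum shift (fun w => f w - c) n x = birkhoffSum shift f n x - n * c := by
  simp [birkhoffSum]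

lemma IsNormalized.of_coercive (hA : IsTransitive A) (h0 : 0 < lam) (h1 : lam < 1)
    (hf : IsCoercive f) (hfv : HasBoundedVariation lam f) :
    IsNormalized (fun w => f w - maxValue f) fun n => (variation lam f n).toReal := by
  have hm := hfv.hasSummableModulus h0 h1
  have hmod : HasSummableModulus (fun w => f w - maxValue f)
      fun n => (variation lam f n).toReal :=
    ⟨hm.nonneg, hm.summable, fun n hn x y h => by simpa using hm.bound n hn x y h⟩
  have hbdd : BddAbove {c : ℝ | ∃ μ : Measure (MarkovShift A),
      IsInvariantProb μ ∧ Integrable f μ ∧ ∫ x, f x ∂μ = c} := by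
    obtain ⟨B, hB⟩ := hm.exists_le hA (hf.exists_forall_lt 0)
    refine ⟨B, ?_⟩
    rintro _ ⟨μ, ⟨hμ, -⟩, hi, rfl⟩
    simpa using integral_mono hi (integrable_const B) hB
  refine ⟨hmod, fun n x hx => ?_, ?_⟩
  · rcases n.eq_zero_or_pos with rfl | hn
    · simpa using hmod.tail_nonneg 1
    · obtain ⟨μ, hμ, hi, hint⟩ :=
        exists_isInvariantProb_integral hn (shift_iterate_periodize hn hx) f
      have hle : birkhoffSum shift f n (periodize n hn x hx) / n ≤ maxValue f :=
        le_csSup hbdd ⟨μ, hμ, hi, hint⟩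
      rw [div_le_iff₀ (by exact_mod_cast hn)] at hle
      have := hmod.birkhoffSum_sub_le le_rfl (agree_periodize hn hx)
      rw [birkhoffSum_sub_const _ n (periodize n hn x hx)] at this
      linarith
  · intro c
    obtain ⟨J, hJ⟩ := hf.exists_forall_lt (c + maxValue f)
    exact ⟨J, fun x hx => by linarith [hJ x hx]⟩

end MarkovShift

open MarkovShift in
theorem theoremA (A : ℕ → ℕ → Fin 2) (hA : MarkovShift.IsTransitive A)
    (lam : ℝ) (hlam0 : 0 < lam) (hlam1 : lam < 1)
    (f : MarkovShift A → ℝ) (hf : MarkovShift.IsCoercive f)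
    (hfv : MarkovShift.HasBoundedVariation lam f)
    (μ : Measure (MarkovShift A)) (hμ : MarkovShift.IsMaximizingMeasure f μ)
    (y : MarkovShift A) (hy : y ∈ μ.support) :
    ∃ S : MarkovShift A → ℝ,
      MarkovShift.IsPeierlsBarrier lam f y S ∧
      MarkovShift.IsCalibratedSubaction f S ∧
      MarkovShift.IsUniformlyContinuous lam S ∧
      (∀ n : ℕ, MarkovShift.variation lam S n ≤ ∑' j : ℕ, MarkovShift.variation lam f (n + j)) ∧
      BddAbove (Set.range S) := by
  set g : MarkovShift A → ℝ := fun w => f w - maxValue f with hgdef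
  set v : ℕ → ℝ := fun n => (variation lam f n).toReal with hvdef
  have hg : IsNormalized g v := .of_coercive hA hlam0 hlam1 hf hfv
  obtain ⟨hinv, hi, hmax⟩ := hμ
  have hprob := hinv.1
  have hr : HasGoodReturns g v y := by
    refine hg.hasGoodReturns hA hinv (hi.sub (integrable_const _)) ?_ hy
    rw [integral_sub hi (integrable_const _), hmax]
    simp
  have hmod : ∀ p, 1 ≤ p → ∀ x x', Agree p x x' →
      |peierls g y x - peierls g y x'| ≤ tail v p := fun p hp x x' h => by
    rw [abs_le]
    constructor <;>
      linarith [hg.peierls_le_add_tail hA hr hp h, hg.peierls_le_add_tail hA hr hp h.symm]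
  refine ⟨peierls g y, fun x => ?_, ⟨fun x => ?_, fun x => ?_⟩, fun ε hε => ?_, fun n => ?_, ?_⟩
  · refine tendsto_order.2 ⟨fun a ha => ?_, fun b hb => ?_⟩
    · filter_upwards [self_mem_nhdsWithin] with ε hε
      refine ha.trans_le (EReal.ge_of_forall_gt_iff_ge.1 fun c hc => ?_)
      obtain ⟨k, hk⟩ := exists_pow_lt_of_lt_one hε hlam1
      have hc' : c < barrier g y (k + 1) (k + 1) x :=
        (EReal.coe_lt_coe_iff.1 hc).trans_le (hg.peierls_le_barrier hA hr (by omega) x)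
      obtain ⟨t, ⟨n, z, -, hz, hx, rfl⟩, hct⟩ :=
        exists_lt_of_lt_csSup (hg.nonempty_arrivalSums hA hr (by omega) x) hc'
      refine (EReal.coe_le_coe_iff.2 hct.le).trans ?_
      exact le_iSup_of_le n (le_iSup₂_of_le z
        ⟨((shiftDist_le_pow_iff hlam0 hlam1).2 (hz.mono k.le_succ)).trans_lt hk, hx⟩ le_rfl)
    · obtain ⟨c, hc, hcb⟩ := EReal.lt_iff_exists_real_btwn.1 hb
      have hlim := (hg.tendsto_barrier hA hr x).add ((tendsto_tail (v := v)).const_mul 2)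
      rw [mul_zero, add_zero] at hlim
      obtain ⟨k, hk, hk1⟩ := ((hlim.eventually_lt_const (EReal.coe_lt_coe_iff.1 hc)).and
        (eventually_ge_atTop 1)).exists
      filter_upwards [Ioo_mem_nhdsGT (pow_pos hlam0 k)] with ε hε
      refine lt_of_le_of_lt (iSup_le fun n => iSup₂_le fun z hz => ?_) hcb
      have hag := (shiftDist_le_pow_iff hlam0 hlam1).1 (hz.1.trans hε.2).le
      exact EReal.coe_le_coe_iff.2
        ((hg.le_barrier_add_tail hA hr hk1 ⟨n, z, n.zero_le, hag, hz.2, rfl⟩).trans hk.le)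
  · have := hg.peierls_add_le_shift hA hr x
    simp only [hgdef] at this ⊢
    linarith
  · obtain ⟨w, hw, hwx⟩ := hg.exists_shift_eq hA hr x
    refine ⟨w, hw, ?_⟩
    simp only [hgdef] at hwx ⊢
    linarith
  · obtain ⟨p, hp, hp1⟩ := (((tendsto_tail (v := v)).eventually_lt_const hε).and
      (eventually_ge_atTop 1)).exists
    exact ⟨lam ^ p, pow_pos hlam0 p, fun x x' h =>
      (hmod p hp1 x x' ((shiftDist_le_pow_iff hlam0 hlam1).1 h.le)).trans_lt hp⟩
  · rcases n.eq_zero_or_pos with rfl | hn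
    · refine le_of_le_of_eq le_top (ENNReal.tsum_eq_top_of_eq_top ⟨0, ?_⟩).symm
      exact hf.variation_zero hA hlam0 hlam1
    · rw [← hfv.ofReal_tail hn]
      exact iSup_le fun x => iSup₂_le fun x' h => ENNReal.ofReal_le_ofReal
        (hmod n hn x x' ((shiftDist_le_pow_iff hlam0 hlam1).1 h))
  · obtain ⟨K, hK⟩ := hg.exists_peierls_le hA hr
    exact ⟨K, Set.forall_mem_range.2 hK⟩
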